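/- Let $F$ be a field of arbitrary characteristic, $F_s$ a separable closure of $F$ and $\Gamma=\mathrm{Gal}(F_s/F)$. Let $n\ge 1$, let $A$ be a central simple $F$-algebra of degree $2n$ with a quadratic pair $(\sigma,f)$: $\sigma$ is an $F$-linear involution of $A$ with $\dim_F\mathrm{Sym}(A,\sigma)=n(2n+1)$ and $\mathrm{Trd}_A(x)=0$ whenever $\sigma(x)=-x$, and $f\colon \mathrm{Sym}(A,\sigma)\to F$ is a linear map with $f(x+\sigma(x))=\mathrm{Trd}_A(x)$ for all $x\in A$. Write $A_s=A\otimes_F F_s$, and let $(\sigma_s,f_s)$ be the extension of $(\sigma,f)$ to $A_s$. A right ideal $I\subset A_s$ is isotropic if $\sigma_s(I)\cdot I=\{0\}$ and $f_s(I\cap\mathrm{Sym}(A_s,\sigma_s))=\{0\}$. The $(k-1)$-dimensional linear varieties of the Severi–Brauer variety $\mathrm{SB}(A)$ are the right ideals of $A_s$ of $F_s$-dimension $2nk$ (points for $k=1$), and the quadric $Q(\sigma,f)\subset\mathrm{SB}(A)$ is the set of isotropic points. Let $L$ be an étale $F$-algebra of dimension $2n$ and $\sigma_L$ an involution of $L$,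 i.e. an $F$-automorphism of order $2$ such that $\xi\mapsto\xi\circ\sigma_L$ has no fixed point on the $\Gamma$-set $X(L)=\mathrm{Hom}_{F\text{-alg}}(L,F_s)$. Let $\varepsilon\colon L\hookrightarrow A$ be an embedding of algebras with involution $(L,\sigma_L)\hookrightarrow(A,\sigma,f)$, i.e. an injective $F$-algebra homomorphism with $\varepsilon\circ\sigma_L=\sigma\circ\varepsilon$ and $f(x)=\mathrm{Trd}_A(\varepsilon(\ell)x)$ for all $x\in\mathrm{Sym}(A,\sigma)$ and all $\ell\in L$ with $\ell+\sigma_L(\ell)=1$. For $\xi\in X(L)$ put $$\varepsilon_*(\xi)=\{x\in A_s \mid (1\otimes\xi(\ell))\,x=(\varepsilon(\ell)\otimes 1)\,x\ \text{ for all } \ell\in L\}.$$ Then $\varepsilon_*$ is an embedding of the thin quadric $Y(L,\sigma_L)=\bigl(X(L),\ \xi\mapsto\xi\circ\sigma_L\bigr)$ into the quadric $Q(\sigma,f)$. Explicitly: (1) $Y(L,\sigma_L)$ is a thin quadric of dimension $2(n-1)$: $X(L)$ is a finite set of $2n$ elements with continuous $\Gamma$-action, and $\xi\mapsto\xi\circ\sigma_L$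 is a $\Gamma$-equivariant map of order $2$ without fixed points. (2) $\varepsilon_*$ is a general embedding $X(L)\hookrightarrow\mathrm{SB}(A)$: each $\varepsilon_*(\xi)$ is a right ideal of dimension $2n$, $\varepsilon_*$ is injective and $\Gamma$-equivariant, and no proper right ideal of $A_s$ contains all the $\varepsilon_*(\xi)$. (3) For every subset $S\subset X(L)$ that is isotropic (contains no pair $\{\xi,\xi\circ\sigma_L\}$), the right ideal $\sum_{\xi\in S}\varepsilon_*(\xi)$ has dimension $2n\,|S|$, is isotropic, and all the points of $\mathrm{SB}(A)$ contained in it lie on $Q(\sigma,f)$. (4) In particular, for every maximal isotropic subset $\omega$ of $X(L)$ (a section of the double covering $X(L)\to X(L)/\sigma_L$), the right ideal $\sum_{\xi\in\omega}\varepsilon_*(\xi)$ is an $(n-1)$-dimensional linear variety that lies in $Q(\sigma,f)$. -/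

import Mathlib

open scoped TensorProduct

noncomputable section

namespace ThinQuadric

/-! ### Central simple algebras and the reduced trace

Throughout, `Fs` is a separable closure of the field `F`, the absolute Galois group is
`Fs ≃ₐ[F] Fs`, and the scalar extension `A_s` of an algebra `A` is written `Fs ⊗[F] A`
(scalars on the left). -/

/-- `A` is a central simple `F`-algebra of degree `d`: the algebra `A_s` is isomorphic, over `Fs`,
to the algebra of endomorphisms of a `d`-dimensional `Fs`-vector space. -/
def IsCentralSimpleOfDegree (F Fs : Type*) [Field F] [Field Fs] [Algebra F Fs] (d : ℕ)
    (A : Type*) [Ring A] [Algebra F A] : Prop :=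
  0 < d ∧ Nonempty ((Fs ⊗[F] A) ≃ₐ[Fs] Module.End Fs (Fin d → Fs))

section Trd

variable {F Fs : Type*} [Field F] [Field Fs] [Algebra F Fs]
  {d : ℕ} {A : Type*} [Ring A] [Algebra F A]

/-- The ring automorphism `γ ⊗ id` of `A_s` induced by an element `γ` of the Galois group. -/
def galAut (A : Type*) [Ring A] [Algebra F A] (γ : Fs ≃ₐ[F] Fs) :
    (Fs ⊗[F] A) ≃ₐ[F] (Fs ⊗[F] A) :=
  Algebra.TensorProduct.congr γ AlgEquiv.refl

@[simp] lemma galAut_tmul (γ : Fs ≃ₐ[F] Fs) (c : Fs) (a : A) :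
    galAut A γ (c ⊗ₜ[F] a) = γ c ⊗ₜ[F] a := rfl

lemma galAut_smul (γ : Fs ≃ₐ[F] Fs) (c : Fs) (x : Fs ⊗[F] A) :
    galAut A γ (c • x) = γ c • galAut A γ x := by
  induction x with
  | zero => simp
  | add x y hx hy => rw [smul_add, map_add, hx, hy, map_add, smul_add]
  | tmul b a => simp [TensorProduct.smul_tmul']

/-- Conjugating a splitting of `A_s` by a Galois automorphism. -/
def twistSplitting (γ : Fs ≃ₐ[F] Fs) (α : (Fs ⊗[F] A) ≃ₐ[Fs] Matrix (Fin d) (Fin d) Fs) :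
    (Fs ⊗[F] A) ≃ₐ[Fs] Matrix (Fin d) (Fin d) Fs :=
  AlgEquiv.ofRingEquiv
    (f := ((galAut A γ.symm).toRingEquiv.trans α.toRingEquiv).trans γ.toRingEquiv.mapMatrix)
    (fun c => by
      have h : galAut A γ.symm (algebraMap Fs (Fs ⊗[F] A) c)
          = algebraMap Fs (Fs ⊗[F] A) (γ.symm c) := by
        rw [Algebra.algebraMap_eq_smul_one, galAut_smul, map_one,
          ← Algebra.algebraMap_eq_smul_one]
      change (α (galAut A γ.symm (algebraMap Fs (Fs ⊗[F] A) c))).map γ = _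
      rw [h, AlgEquiv.commutes, Matrix.algebraMap_eq_diagonal, Matrix.algebraMap_eq_diagonal,
        Matrix.diagonal_map (map_zero γ)]
      congr 1
      funext i
      simp)

lemma trace_splitting_eq (α β : (Fs ⊗[F] A) ≃ₐ[Fs] Module.End Fs (Fin d → Fs))
    (x : Fs ⊗[F] A) :
    LinearMap.trace Fs (Fin d → Fs) (α x) = LinearMap.trace Fs (Fin d → Fs) (β x) := by
  obtain ⟨e, he⟩ := (α.symm.trans β).eq_linearEquivConjAlgEquiv
  have h : β x = e.conj (α x) := by
    have := congrArg (fun g => g (α x)) he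
    simp only [AlgEquiv.trans_apply, AlgEquiv.symm_apply_apply] at this
    exact this
  rw [h, LinearMap.trace_conj']

lemma exists_trace_mem [IsSepClosure F Fs]
    (α : (Fs ⊗[F] A) ≃ₐ[Fs] Module.End Fs (Fin d → Fs)) (a : A) :
    ∃ c : F, algebraMap F Fs c = LinearMap.trace Fs (Fin d → Fs) (α (1 ⊗ₜ[F] a)) := by
  have : IsGalois F Fs := inferInstance
  have key : ∀ γ : Fs ≃ₐ[F] Fs, γ (LinearMap.trace Fs (Fin d → Fs) (α (1 ⊗ₜ[F] a)))
      = LinearMap.trace Fs (Fin d → Fs) (α (1 ⊗ₜ[F] a)) := by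
    intro γ
    set α' : (Fs ⊗[F] A) ≃ₐ[Fs] Matrix (Fin d) (Fin d) Fs :=
      α.trans LinearMap.toMatrixAlgEquiv' with hα'
    have h1 : ∀ y, LinearMap.trace Fs (Fin d → Fs) (α y) = Matrix.trace (α' y) := fun y => by
      rw [LinearMap.trace_eq_matrix_trace Fs (Pi.basisFun Fs (Fin d))]
      rfl
    have h2 := trace_splitting_eq ((twistSplitting γ α').trans Matrix.toLinAlgEquiv') α
      (1 ⊗ₜ[F] a)
    rw [h1] at h2 ⊢
    have h3 : ∀ M : Matrix (Fin d) (Fin d) Fs,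
        LinearMap.trace Fs (Fin d → Fs) (Matrix.toLinAlgEquiv' M) = Matrix.trace M := fun M => by
      rw [LinearMap.trace_eq_matrix_trace Fs (Pi.basisFun Fs (Fin d))]
      congr 1
      exact LinearMap.toMatrix'_toLin' M
    rw [AlgEquiv.trans_apply, h3] at h2
    have h4 : twistSplitting γ α' (1 ⊗ₜ[F] a) = (α' (1 ⊗ₜ[F] a)).map γ := by
      change (α' (galAut A γ.symm (1 ⊗ₜ[F] a))).map γ = _
      simp
    rw [h4] at h2
    conv_rhs => rw [← h2]
    simp [Matrix.trace]
  exact (InfiniteGalois.mem_range_algebraMap_iff_fixed _).2 key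

theorem existsUnique_reducedTrace [IsSepClosure F Fs] (hA : IsCentralSimpleOfDegree F Fs d A) :
    ∃! t : A →ₗ[F] F, ∀ (α : (Fs ⊗[F] A) ≃ₐ[Fs] Module.End Fs (Fin d → Fs)) (a : A),
      algebraMap F Fs (t a) = LinearMap.trace Fs (Fin d → Fs) (α (1 ⊗ₜ[F] a)) := by
  obtain ⟨-, ⟨α⟩⟩ := hA
  choose t ht using exists_trace_mem α
  have inj := (algebraMap F Fs).injective
  refine ⟨⟨⟨t, fun a b => inj ?_⟩, fun c a => inj ?_⟩, fun β a => ?_, fun u hu => ?_⟩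
  · rw [map_add, ht, ht, ht, TensorProduct.tmul_add, map_add, map_add]
  · have h : (1 : Fs) ⊗ₜ[F] (c • a) = algebraMap F Fs c • ((1 : Fs) ⊗ₜ[F] a) := by
      rw [TensorProduct.tmul_smul, algebraMap_smul]
    simp only [RingHom.id_apply, smul_eq_mul, map_mul]
    rw [ht, ht, h, map_smul, map_smul, smul_eq_mul]
  · exact (ht a).trans (trace_splitting_eq α β _)
  · ext a
    exact inj ((hu α a).trans (ht a).symm)

/-- The reduced trace `Trd_A : A → F`: the trace of `1 ⊗ a` in `A_s ≃ End(V)`, which does not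
depend on the isomorphism and lies in `F`. -/
def reducedTrace [IsSepClosure F Fs] (hA : IsCentralSimpleOfDegree F Fs d A) : A →ₗ[F] F :=
  (existsUnique_reducedTrace hA).choose

lemma algebraMap_reducedTrace [IsSepClosure F Fs] (hA : IsCentralSimpleOfDegree F Fs d A)
    (α : (Fs ⊗[F] A) ≃ₐ[Fs] Module.End Fs (Fin d → Fs)) (a : A) :
    algebraMap F Fs (reducedTrace hA a) = LinearMap.trace Fs (Fin d → Fs) (α (1 ⊗ₜ[F] a)) :=
  (existsUnique_reducedTrace hA).choose_spec.1 α a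

end Trd

/-! ### Involutions and quadratic pairs -/

/-- An involution: an `F`-linear anti-automorphism of order `2`. -/
structure IsInvolution {F B : Type*} [Field F] [Ring B] [Algebra F B] (σ : B →ₗ[F] B) : Prop where
  map_mul : ∀ x y, σ (x * y) = σ y * σ x
  involutive : ∀ x, σ (σ x) = x
  ne_id : σ ≠ LinearMap.id

/-- The space `Sym(B, σ)` of symmetric elements. -/
def Sym {F B : Type*} [Field F] [Ring B] [Algebra F B] (σ : B →ₗ[F] B) : Submodule F B :=
  LinearMap.eqLocus σ LinearMap.id

lemma mem_Sym {F B : Type*} [Field F] [Ring B] [Algebra F B] {σ : B →ₗ[F] B} {x : B} :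
    x ∈ Sym σ ↔ σ x = x := Iff.rfl

section QuadraticPair

variable {F Fs : Type*} [Field F] [Field Fs] [Algebra F Fs] {A : Type*} [Ring A] [Algebra F A]

/-- `(σ, f)` is a quadratic pair on the central simple algebra `A` of degree `2n`. -/
structure IsQuadraticPair [IsSepClosure F Fs] {n : ℕ}
    (hA : IsCentralSimpleOfDegree F Fs (2 * n) A) (σ : A →ₗ[F] A) (f : Sym σ →ₗ[F] F) : Prop where
  isInvolution : IsInvolution σ
  finrank_sym : Module.finrank F (Sym σ) = n * (2 * n + 1)
  trd_skew : ∀ x, σ x = -x → reducedTrace hA x = 0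
  map_symd : ∀ (x : A) (y : Sym σ), (y : A) = x + σ x → f y = reducedTrace hA x

lemma eqLocus_lTensor (σ : A →ₗ[F] A) :
    LinearMap.eqLocus (TensorProduct.AlgebraTensorModule.lTensor Fs Fs σ)
      (TensorProduct.AlgebraTensorModule.lTensor Fs Fs (LinearMap.id : A →ₗ[F] A))
      = Sym (σ.baseChange Fs) := by
  ext x
  have h : TensorProduct.AlgebraTensorModule.lTensor Fs Fs (LinearMap.id : A →ₗ[F] A) x = x := by
    simp
  rw [LinearMap.mem_eqLocus, mem_Sym, h]
  rfl

/-- The canonical isomorphism `Fs ⊗ Sym(A, σ) ≃ Sym(A_s, σ_s)`, where `σ_s = id ⊗ σ`. -/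
def symBaseChange (Fs : Type*) [Field Fs] [Algebra F Fs] (σ : A →ₗ[F] A) :
    (Fs ⊗[F] Sym σ) ≃ₗ[Fs] Sym (σ.baseChange Fs) :=
  (LinearMap.tensorEqLocusEquiv Fs Fs σ LinearMap.id).trans
    (LinearEquiv.ofEq _ _ (eqLocus_lTensor σ))

lemma symBaseChange_tmul (σ : A →ₗ[F] A) (c : Fs) (x : Sym σ) :
    (symBaseChange Fs σ (c ⊗ₜ[F] x) : Fs ⊗[F] A) = c ⊗ₜ[F] (x : A) := rfl

/-- The `Fs`-linear extension `f_s : Sym(A_s, σ_s) → Fs` of `f`. -/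
def extendForm (Fs : Type*) [Field Fs] [Algebra F Fs] {σ : A →ₗ[F] A} (f : Sym σ →ₗ[F] F) :
    Sym (σ.baseChange Fs) →ₗ[Fs] Fs :=
  (TensorProduct.AlgebraTensorModule.rid F Fs Fs).toLinearMap ∘ₗ f.baseChange Fs ∘ₗ
    (symBaseChange Fs σ).symm.toLinearMap

lemma extendForm_tmul {σ : A →ₗ[F] A} (f : Sym σ →ₗ[F] F) (c : Fs) (x : Sym σ) :
    extendForm Fs f (symBaseChange Fs σ (c ⊗ₜ[F] x)) = c * algebraMap F Fs (f x) := by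
  simp [extendForm, Algebra.smul_def, mul_comm]

end QuadraticPair

/-! ### Severi–Brauer varieties and quadrics -/

/-- Right ideals of a ring; `⊔`, `⨆` are sums of right ideals. -/
abbrev RightIdeal (R : Type*) [Ring R] := Submodule Rᵐᵒᵖ R

section Geometry

variable {F Fs : Type*} [Field F] [Field Fs] [Algebra F Fs] {A : Type*} [Ring A] [Algebra F A]

/-- The Galois action on right ideals of `A_s`. -/
def galIdeal (γ : Fs ≃ₐ[F] Fs) (I : RightIdeal (Fs ⊗[F] A)) : RightIdeal (Fs ⊗[F] A) where
  carrier := galAut A γ '' I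
  zero_mem' := ⟨0, I.zero_mem, map_zero _⟩
  add_mem' := by
    rintro _ _ ⟨x, hx, rfl⟩ ⟨y, hy, rfl⟩
    exact ⟨x + y, I.add_mem hx hy, map_add _ _ _⟩
  smul_mem' := by
    rintro b _ ⟨x, hx, rfl⟩
    refine ⟨x * (galAut A γ).symm b.unop, I.smul_mem (MulOpposite.op _) hx, ?_⟩
    rw [map_mul, AlgEquiv.apply_symm_apply]
    rfl

/-- `Gr_{k-1}(SB(A))` for `A` of degree `d`: the `(k-1)`-dimensional linear varieties of `SB(A)`
are the right ideals of `A_s` of dimension `d * k` over `Fs`. -/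
def linearVarieties (F Fs A : Type*) [Field F] [Field Fs] [Algebra F Fs] [Ring A] [Algebra F A]
    (d k : ℕ) : Set (RightIdeal (Fs ⊗[F] A)) :=
  {I | Module.finrank Fs I = d * k}

/-- The points of the Severi–Brauer variety of `A`. -/
def severiBrauer (F Fs A : Type*) [Field F] [Field Fs] [Algebra F Fs] [Ring A] [Algebra F A]
    (d : ℕ) : Set (RightIdeal (Fs ⊗[F] A)) :=
  linearVarieties F Fs A d 1

/-- The right ideal `I` of `A_s` is isotropic for `(σ_s, f_s)`. -/
def IsIsotropicIdeal {σ : A →ₗ[F] A} (f : Sym σ →ₗ[F] F) (I : RightIdeal (Fs ⊗[F] A)) : Prop :=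
  (∀ x ∈ I, ∀ y ∈ I, σ.baseChange Fs x * y = 0) ∧
    ∀ x : Sym (σ.baseChange Fs), (x : Fs ⊗[F] A) ∈ I → extendForm Fs f x = 0

/-- The quadric `Q(σ, f)` in `SB(A)`, for `A` of degree `2n`. -/
def quadric (Fs : Type*) [Field Fs] [Algebra F Fs] (n : ℕ) {σ : A →ₗ[F] A} (f : Sym σ →ₗ[F] F) :
    Set (RightIdeal (Fs ⊗[F] A)) :=
  {I | I ∈ severiBrauer F Fs A (2 * n) ∧ IsIsotropicIdeal f I}

/-- The `(k-1)`-dimensional linear varieties of `SB(A)` (`A` of degree `d`) all of whose points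
lie in `Q`. -/
def linearVarietiesIn (d k : ℕ) (Q : Set (RightIdeal (Fs ⊗[F] A))) :
    Set (RightIdeal (Fs ⊗[F] A)) :=
  {I | I ∈ linearVarieties F Fs A d k ∧ ∀ J ∈ severiBrauer F Fs A d, J ≤ I → J ∈ Q}

/-- The Clifford set `C(Q)` of a quadric `Q` in a `(2n-1)`-dimensional `SB(A)`: the
`(n-1)`-dimensional linear varieties that lie in `Q`. -/
def cliffordSetOfQuadric (n : ℕ) (Q : Set (RightIdeal (Fs ⊗[F] A))) :
    Set (RightIdeal (Fs ⊗[F] A)) :=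
  linearVarietiesIn (2 * n) n Q

end Geometry

/-! ### Galois sets and thin quadrics -/

/-- Finite sets with a continuous action of a topological group. -/
structure IsGammaSet (Γ X : Type*) [Group Γ] [TopologicalSpace Γ] [MulAction Γ X] : Prop where
  finite : Finite X
  isOpen_stabilizer : ∀ x : X, IsOpen (MulAction.stabilizer Γ x : Set Γ)

/-- `(X, τ)` is a thin `2(n-1)`-dimensional `Γ`-quadric: a `Γ`-set of `2n` elements with an
involution (an equivariant map of order `2` without fixed points). -/
structure IsThinQuadric (Γ : Type*) {X : Type*} [Group Γ] [TopologicalSpace Γ] [MulAction Γ X]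
    (n : ℕ) (τ : X → X) : Prop where
  isGammaSet : IsGammaSet Γ X
  card_eq : Nat.card X = 2 * n
  equivariant : ∀ (γ : Γ) (x : X), τ (γ • x) = γ • τ x
  involutive : ∀ x, τ (τ x) = x
  fixedPointFree : ∀ x, τ x ≠ x

/-- Isotropic linear subvarieties of a thin quadric: subsets containing no pair `{x, τ x}`. -/
def IsIsotropicSubset {X : Type*} (τ : X → X) (s : Finset X) : Prop :=
  ∀ x ∈ s, τ x ∉ s

/-- The Clifford set `C(X, τ)`: the maximal isotropic linear subvarieties. -/
def cliffordSet {X : Type*} (τ : X → X) : Set (Finset X) :=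
  {s | Maximal (IsIsotropicSubset τ) s}

/-- The linear variety spanned by the images of the points of `s`. -/
def grMap {X R : Type*} [Ring R] (φ : X → RightIdeal R) (s : Finset X) : RightIdeal R :=
  ⨆ x ∈ s, φ x

section Embeddings

variable {F Fs : Type*} [Field F] [Field Fs] [Algebra F Fs] {A : Type*} [Ring A] [Algebra F A]
  {X : Type*} [MulAction (Fs ≃ₐ[F] Fs) X]

/-- General embeddings of a Galois set `X` of `d` elements in `SB(A)`, for `A` of degree `d`:
injective equivariant maps whose image is not contained in a proper linear subspace. -/
structure IsGeneralEmbedding (d : ℕ) (φ : X → RightIdeal (Fs ⊗[F] A)) : Prop where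
  isGammaSet : IsGammaSet (Fs ≃ₐ[F] Fs) X
  card_eq : Nat.card X = d
  mem_severiBrauer : ∀ x, φ x ∈ severiBrauer F Fs A d
  injective : Function.Injective φ
  equivariant : ∀ (γ : Fs ≃ₐ[F] Fs) (x : X), φ (γ • x) = galIdeal γ (φ x)
  general_position : ∀ I : RightIdeal (Fs ⊗[F] A), (∀ x, φ x ≤ I) → I = ⊤

/-- Embeddings of a thin quadric `(X, τ)` of dimension `2(n-1)` in a quadric `Q` of a
`(2n-1)`-dimensional `SB(A)`: general embeddings which carry isotropic linear subvarieties of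
`(X, τ)` to linear varieties of the same dimension that lie in `Q`. -/
structure IsQuadricEmbedding (n : ℕ) (τ : X → X) (Q : Set (RightIdeal (Fs ⊗[F] A)))
    (φ : X → RightIdeal (Fs ⊗[F] A)) : Prop where
  isThinQuadric : IsThinQuadric (Fs ≃ₐ[F] Fs) n τ
  isGeneralEmbedding : IsGeneralEmbedding (2 * n) φ
  map_isotropic : ∀ s : Finset X, IsIsotropicSubset τ s →
    grMap φ s ∈ linearVarietiesIn (2 * n) s.card Q

end Embeddings

/-! ### Étale algebras with involution -/

section Etale

variable (F Fs L : Type*) [Field F] [Field Fs] [Algebra F Fs] [CommRing L] [Algebra F L]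

/-- The Galois set `X(L)` of `F`-algebra homomorphisms `L → Fs`. -/
abbrev EtaleSet := L →ₐ[F] Fs

instance : MulAction (Fs ≃ₐ[F] Fs) (EtaleSet F Fs L) where
  smul γ ξ := AlgHom.comp (γ : Fs →ₐ[F] Fs) ξ
  one_smul _ := AlgHom.ext fun _ => rfl
  mul_smul _ _ _ := AlgHom.ext fun _ => rfl

variable {F L}

/-- The map `X(σ) : X(L) → X(L)`, `ξ ↦ ξ ∘ σ`. -/
def etaleSetMap (σ : L ≃ₐ[F] L) (ξ : EtaleSet F Fs L) : EtaleSet F Fs L :=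
  AlgHom.comp ξ (σ : L →ₐ[F] L)

/-- Involutions of an étale algebra `L`: automorphisms of order `2` such that `X(σ)` has no fixed
points. -/
structure IsEtaleInvolution (σ : L ≃ₐ[F] L) : Prop where
  involutive : ∀ x, σ (σ x) = x
  ne_id : σ ≠ AlgEquiv.refl
  fixedPointFree : ∀ ξ : EtaleSet F Fs L, etaleSetMap Fs σ ξ ≠ ξ

variable {Fs} {A : Type*} [Ring A] [Algebra F A]

/-- Embeddings `(L, σ_L) ↪ (A, σ, f)` of algebras with involution. -/
structure IsInvolutionEmbedding [IsSepClosure F Fs] {n : ℕ}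
    (hA : IsCentralSimpleOfDegree F Fs (2 * n) A) (σL : L ≃ₐ[F] L) (σ : A →ₗ[F] A)
    (f : Sym σ →ₗ[F] F) (ε : L →ₐ[F] A) : Prop where
  injective : Function.Injective ε
  map_involution : ∀ l, ε (σL l) = σ (ε l)
  map_form : ∀ (x : Sym σ) (l : L), l + σL l = 1 → f x = reducedTrace hA (ε l * x)

/-- The right ideal `ε_*(ξ) = {x ∈ A_s | ξ(l) · x = (1 ⊗ ε(l)) · x for all l ∈ L}`. -/
def epsStar (ε : L →ₐ[F] A) (ξ : EtaleSet F Fs L) : RightIdeal (Fs ⊗[F] A) where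
  carrier := {x | ∀ l : L, ξ l • x = ((1 : Fs) ⊗ₜ[F] ε l) * x}
  zero_mem' := by simp
  add_mem' := by
    intro x y hx hy l
    rw [smul_add, mul_add, hx l, hy l]
  smul_mem' := by
    intro b x hx l
    change _ • (x * b.unop) = _ * (x * b.unop)
    rw [← smul_mul_assoc, hx l, mul_assoc]

end Etale

end ThinQuadric

end

noncomputable section

namespace ThinQuadric

/-! ### Étale algebras over a separably closed extension -/

section EtaleEval

variable (F Fs L : Type*) [Field F] [Field Fs] [Algebra F Fs] [CommRing L] [Algebra F L]

/-! Over `Fs` the étale algebra splits as `Fs ^ X(L)` (`etaleEval_bijective`). Pushing its primitive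
idempotents through `ε` gives nonzero orthogonal idempotents `e_ξ` of `A_s` with sum `1`, and
`ε_*(ξ) = e_ξ A_s`. So `A_s` is the direct sum of the `ε_*(ξ)`. Nonzero right ideals have dimension
at least the degree `d` (`le_finrank_of_ne_zero`), and `d` of them add up to `d²`, so each has
dimension exactly `d` (`finrank_epsStar`).

For isotropy, let `s` be isotropic and `e = ∑_{ξ ∈ s} e_ξ`. Comparing eigenvalues of `ε(l)` shows
`σ_s(ε_*(ξ)) ε_*(η) = 0` unless `η = ξ ∘ σ_L` (`baseChange_mul_eq_zero`), so `σ_s(e A_s) e A_s = 0`.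
For the form, choose `l` with `l + σ_L l = 1` (`exists_add_involution_eq_one`), so that `f_s(x) =
tr(ε(l) x)`. A symmetric `x` in `e A_s` satisfies `e x = x` and `x e = 0`; since `e` commutes with
`ε(l)`, cyclicity of the trace gives `f_s(x) = tr(ε(l) x e) = 0`. -/

/-- The evaluation map `Fs ⊗ L → Fs ^ X(L)`, `c ⊗ l ↦ (c * ξ l)_ξ`. -/
def etaleEval : (Fs ⊗[F] L) →ₐ[Fs] (EtaleSet F Fs L → Fs) :=
  AlgHom.pi fun ξ => Algebra.TensorProduct.liftEquivRight F Fs L Fs ξ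

variable {F Fs L} in
@[simp] lemma etaleEval_tmul (c : Fs) (l : L) (ξ : EtaleSet F Fs L) :
    etaleEval F Fs L (c ⊗ₜ[F] l) ξ = c * ξ l := by
  simp [etaleEval, Algebra.TensorProduct.liftEquivRight]

variable [Algebra.Etale F L]

/-- An étale algebra over a separably closed field is a product of copies of that field, and each
coordinate projection of `Fs ⊗ L` comes from a point of `X(L)`. An element killed by all evaluations
therefore has all coordinates zero. -/
lemma etaleEval_injective [IsSepClosed Fs] : Function.Injective (etaleEval F Fs L) := by
  rw [injective_iff_map_eq_zero]
  intro x hx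
  set e := Algebra.FormallyEtale.equivPiOfIsSepClosed Fs (Fs ⊗[F] L)
  refine e.injective ((funext fun p => ?_).trans (map_zero e).symm)
  set φ : (Fs ⊗[F] L) →ₐ[Fs] Fs := (Pi.evalAlgHom Fs _ p).comp e.toAlgHom
  have h : etaleEval F Fs L x ((Algebra.TensorProduct.liftEquivRight F Fs L Fs).symm φ) = φ x :=
    DFunLike.congr_fun ((Algebra.TensorProduct.liftEquivRight F Fs L Fs).apply_symm_apply φ) x
  rw [hx] at h
  exact h.symm

lemma finite_etaleSet : Finite (EtaleSet F Fs L) :=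
  have : Module.Finite F L := Algebra.FormallyUnramified.finite_of_free F L
  inferInstance

lemma card_etaleSet [IsSepClosed Fs] :
    Nat.card (EtaleSet F Fs L) = Module.finrank F L := by
  have : Module.Finite F L := Algebra.FormallyUnramified.finite_of_free F L
  have : Fintype (EtaleSet F Fs L) := Fintype.ofFinite _
  refine le_antisymm (card_algHom_le_finrank F L Fs) ?_
  have h := LinearMap.finrank_le_finrank_of_injective (f := (etaleEval F Fs L).toLinearMap)
    (etaleEval_injective F Fs L)
  rwa [Module.finrank_baseChange, Module.finrank_fintype_fun_eq_card,
    ← Nat.card_eq_fintype_card] at h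

lemma etaleEval_bijective [IsSepClosed Fs] : Function.Bijective (etaleEval F Fs L) := by
  have : Module.Finite F L := Algebra.FormallyUnramified.finite_of_free F L
  have : Fintype (EtaleSet F Fs L) := Fintype.ofFinite _
  have hi := etaleEval_injective F Fs L
  refine ⟨hi, (LinearMap.injective_iff_surjective_of_finrank_eq_finrank
    (f := (etaleEval F Fs L).toLinearMap) ?_).1 hi⟩
  rw [Module.finrank_baseChange, Module.finrank_fintype_fun_eq_card,
    ← Nat.card_eq_fintype_card, card_etaleSet]

/-- The canonical isomorphism `Fs ⊗ L ≃ Fs ^ X(L)`. -/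
def etaleEquiv [IsSepClosed Fs] : (Fs ⊗[F] L) ≃ₐ[Fs] (EtaleSet F Fs L → Fs) :=
  AlgEquiv.ofBijective (etaleEval F Fs L) (etaleEval_bijective F Fs L)

variable {F Fs L}

lemma etaleEquiv_apply [IsSepClosed Fs] (z : Fs ⊗[F] L) :
    etaleEquiv F Fs L z = etaleEval F Fs L z := rfl

open Classical in
/-- The primitive idempotent of `Fs ⊗ L` attached to a point of `X(L)`. -/
def etaleIdem [IsSepClosed Fs] (ξ : EtaleSet F Fs L) : Fs ⊗[F] L :=
  (etaleEquiv F Fs L).symm (Pi.single ξ 1)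

open Classical in
lemma etaleEval_etaleIdem [IsSepClosed Fs] (ξ : EtaleSet F Fs L) :
    etaleEval F Fs L (etaleIdem ξ) = Pi.single ξ 1 := by
  rw [← etaleEquiv_apply, etaleIdem, AlgEquiv.apply_symm_apply]

lemma etaleIdem_ne_zero [IsSepClosed Fs] (ξ : EtaleSet F Fs L) : etaleIdem ξ ≠ 0 := by
  classical
  intro h
  have := etaleEval_etaleIdem ξ
  rw [h, map_zero] at this
  simpa using (congrFun this ξ).symm

lemma mul_etaleIdem [IsSepClosed Fs] (z : Fs ⊗[F] L) (ξ : EtaleSet F Fs L) :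
    z * etaleIdem ξ = etaleEval F Fs L z ξ • etaleIdem ξ := by
  classical
  apply etaleEval_injective F Fs L
  rw [map_mul, map_smul, etaleEval_etaleIdem]
  funext η
  by_cases h : η = ξ
  · subst h; simp
  · simp [h]

lemma etaleIdem_mul_of_ne [IsSepClosed Fs] {ξ η : EtaleSet F Fs L} (h : ξ ≠ η) :
    etaleIdem ξ * etaleIdem η = 0 := by
  classical
  rw [mul_etaleIdem, etaleEval_etaleIdem, Pi.single_eq_of_ne h.symm, zero_smul]

lemma sum_etaleIdem [IsSepClosed Fs] [Fintype (EtaleSet F Fs L)] :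
    ∑ ξ : EtaleSet F Fs L, etaleIdem ξ = (1 : Fs ⊗[F] L) := by
  classical
  apply etaleEval_injective F Fs L
  simp only [map_sum, etaleEval_etaleIdem, map_one]
  exact Finset.univ_sum_single (1 : EtaleSet F Fs L → Fs)

end EtaleEval

/-! ### Thin quadrics -/

/-- A maximal isotropic subset meets every orbit of the involution. -/
lemma mem_or_mem_of_mem_cliffordSet {X : Type*} {τ : X → X} (hτ : ∀ x, τ (τ x) = x)
    (hfix : ∀ x, τ x ≠ x) {ω : Finset X} (hω : ω ∈ cliffordSet τ) (x : X) : x ∈ ω ∨ τ x ∈ ω := by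
  classical
  by_contra! h
  -- If `x` and `τ x` both lie outside `ω`, adjoining `x` keeps `ω` isotropic, against maximality.
  refine h.1 (hω.2 (y := insert x ω) (fun y hy => ?_) (Finset.subset_insert x ω)
    (Finset.mem_insert_self x ω))
  rw [Finset.mem_insert] at hy ⊢
  rintro (h1 | h1) <;> rcases hy with rfl | hy
  · exact hfix _ h1
  · exact h.2 (h1 ▸ (hτ y).symm ▸ hy)
  · exact h.2 h1
  · exact hω.1 y hy h1

lemma two_mul_card_of_mem_cliffordSet {X : Type*} {τ : X → X} (hτ : ∀ x, τ (τ x) = x)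
    (hfix : ∀ x, τ x ≠ x) {ω : Finset X} (hω : ω ∈ cliffordSet τ) :
    2 * ω.card = Nat.card X := by
  classical
  have hinj : Function.Injective τ := Function.LeftInverse.injective hτ
  have hdisj : Disjoint ω (ω.image τ) := by
    rw [Finset.disjoint_left]
    rintro x hx hx'
    obtain ⟨y, hy, rfl⟩ := Finset.mem_image.1 hx'
    exact hω.1 y hy hx
  have hall : ∀ x, x ∈ ω ∪ ω.image τ := fun x => by
    rw [Finset.mem_union, Finset.mem_image]
    exact (mem_or_mem_of_mem_cliffordSet hτ hfix hω x).imp_right fun h => ⟨_, h, hτ x⟩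
  -- Finiteness of `X` is not assumed; it follows from the covering by `ω` and its image under `τ`.
  have : Fintype X := ⟨_, hall⟩
  rw [Nat.card_eq_fintype_card, Fintype.card, ← Finset.eq_univ_of_forall hall,
    Finset.card_union_of_disjoint hdisj, Finset.card_image_of_injective _ hinj, two_mul]

lemma exists_mem_cliffordSet {X : Type*} [Finite X] (τ : X → X) : ∃ ω, ω ∈ cliffordSet τ := by
  have := Fintype.ofFinite X
  obtain ⟨ω, -, hω⟩ := (Set.toFinite {s : Finset X | IsIsotropicSubset τ s}).exists_le_maximal
    (a := ∅) (by simp [IsIsotropicSubset])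
  exact ⟨ω, hω⟩

/-! ### The thin quadric of an étale algebra with involution -/

section EtaleInvolution

variable {F Fs L : Type*} [Field F] [Field Fs] [Algebra F Fs] [CommRing L] [Algebra F L]

lemma etaleSetMap_involutive {σL : L ≃ₐ[F] L} (h : IsEtaleInvolution Fs σL)
    (ξ : EtaleSet F Fs L) : etaleSetMap Fs σL (etaleSetMap Fs σL ξ) = ξ :=
  AlgHom.ext fun l => congrArg ξ (h.involutive l)

lemma isGammaSet_etaleSet [IsSepClosure F Fs] [Algebra.Etale F L] :
    IsGammaSet (Fs ≃ₐ[F] Fs) (EtaleSet F Fs L) where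
  finite := finite_etaleSet F Fs L
  isOpen_stabilizer ξ := by
    have : Module.Finite F L := Algebra.FormallyUnramified.finite_of_free F L
    have : IsGalois F Fs := inferInstance
    let b := Module.finBasis F L
    -- A point is determined by its finitely many values on a basis of `L`, and each value, being
    -- algebraic over `F`, has open stabilizer.
    have h : (MulAction.stabilizer (Fs ≃ₐ[F] Fs) ξ : Set (Fs ≃ₐ[F] Fs))
        = ⋂ i, (MulAction.stabilizer (Fs ≃ₐ[F] Fs) (ξ (b i)) : Set (Fs ≃ₐ[F] Fs)) := by
      ext γ
      simp only [SetLike.mem_coe, MulAction.mem_stabilizer_iff, Set.mem_iInter]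
      refine ⟨fun hγ i => DFunLike.congr_fun hγ (b i), fun hγ => ?_⟩
      have : (γ • ξ : EtaleSet F Fs L).toLinearMap = ξ.toLinearMap := b.ext hγ
      exact AlgHom.ext fun l => DFunLike.congr_fun this l
    rw [h]
    exact isOpen_iInter_of_finite fun i => stabilizer_isOpen_of_isIntegral _

lemma isThinQuadric_etaleSet [IsSepClosure F Fs] [Algebra.Etale F L] {n : ℕ}
    (hL : Module.finrank F L = 2 * n) {σL : L ≃ₐ[F] L} (hσL : IsEtaleInvolution Fs σL) :
    IsThinQuadric (Fs ≃ₐ[F] Fs) n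
      (etaleSetMap Fs σL : EtaleSet F Fs L → EtaleSet F Fs L) where
  isGammaSet := isGammaSet_etaleSet
  card_eq := by
    have : IsSepClosed Fs := IsSepClosure.sep_closed F
    rw [card_etaleSet, hL]
  equivariant _ _ := rfl
  involutive := etaleSetMap_involutive hσL
  fixedPointFree := hσL.fixedPointFree

/-- An étale algebra with involution contains an element `l` with `l + σ l = 1`. -/
lemma exists_add_involution_eq_one [IsSepClosed Fs] [Algebra.Etale F L]
    {σL : L ≃ₐ[F] L} (hσL : IsEtaleInvolution Fs σL) : ∃ l : L, l + σL l = 1 := by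
  classical
  have := finite_etaleSet F Fs L
  obtain ⟨ω, hω⟩ := exists_mem_cliffordSet (etaleSetMap Fs σL)
  -- `z` is the indicator function of a section `ω`; the involution exchanges `ω` with its
  -- complement, so the two indicators add up to `1`. This avoids dividing by `2`.
  set z : Fs ⊗[F] L := (etaleEquiv F Fs L).symm fun ξ => if ξ ∈ ω then 1 else 0
  have hz : z + σL.toLinearMap.lTensor Fs z = 1 := by
    have hσ : ∀ (y : Fs ⊗[F] L) (ξ : EtaleSet F Fs L),
        etaleEval F Fs L (σL.toLinearMap.lTensor Fs y) ξ
          = etaleEval F Fs L y (etaleSetMap Fs σL ξ) := by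
      intro y ξ
      induction y with
      | zero => simp
      | add x y hx hy => simp only [map_add, Pi.add_apply, hx, hy]
      | tmul c l => simp [etaleSetMap]
    apply etaleEval_injective F Fs L
    funext ξ
    have h1 : etaleEval F Fs L z = fun ξ => if ξ ∈ ω then 1 else 0 := by
      rw [← etaleEquiv_apply]; exact AlgEquiv.apply_symm_apply _ _
    rw [map_add, Pi.add_apply, hσ, h1, map_one, Pi.one_apply]
    rcases mem_or_mem_of_mem_cliffordSet (etaleSetMap_involutive hσL) hσL.fixedPointFree hω ξ
      with h | h
    · simp [h, hω.1 ξ h]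
    · have h' := hω.1 _ h
      rw [etaleSetMap_involutive hσL] at h'
      simp [h, h']
  -- Descent to `L`: an `F`-linear retraction `π` of `F → Fs` induces a map `Fs ⊗ L → L` that
  -- commutes with the involutions and sends `1` to `1`.
  obtain ⟨π, hπ⟩ := (Algebra.linearMap F Fs).exists_leftInverse_of_injective
    (LinearMap.ker_eq_bot.2 (algebraMap F Fs).injective)
  have hπ1 : π 1 = 1 := by simpa using DFunLike.congr_fun hπ 1
  set p : Fs ⊗[F] L →ₗ[F] L := (TensorProduct.lid F L).toLinearMap ∘ₗ π.rTensor L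
  have hp : ∀ y, p (σL.toLinearMap.lTensor Fs y) = σL (p y) := by
    intro y
    induction y with
    | zero => simp
    | add x y hx hy => simp only [map_add, hx, hy]
    | tmul c l => simp [p]
  refine ⟨p z, ?_⟩
  rw [← hp, ← map_add, hz, Algebra.TensorProduct.one_def]
  simp [p, hπ1]

end EtaleInvolution

/-! ### Dimensions of right ideals -/

section Degree

variable {F Fs : Type*} [Field F] [Field Fs] [Algebra F Fs] {A : Type*} [Ring A] [Algebra F A]

lemma finrank_of_isCentralSimple {d : ℕ} (hA : IsCentralSimpleOfDegree F Fs d A) :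
    Module.finrank Fs (Fs ⊗[F] A) = d * d := by
  obtain ⟨-, ⟨α⟩⟩ := hA
  rw [α.toLinearEquiv.finrank_eq, Module.finrank_linearMap]
  simp

lemma finite_of_isCentralSimple {d : ℕ} (hA : IsCentralSimpleOfDegree F Fs d A) :
    Module.Finite Fs (Fs ⊗[F] A) := by
  obtain ⟨-, ⟨α⟩⟩ := hA
  exact Module.Finite.equiv α.toLinearEquiv.symm

/-- A nonzero right ideal of `A_s` has dimension at least the degree. -/
lemma le_finrank_of_ne_zero {d : ℕ} (hA : IsCentralSimpleOfDegree F Fs d A)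
    {I : RightIdeal (Fs ⊗[F] A)} {x : Fs ⊗[F] A} (hx : x ∈ I) (hx0 : x ≠ 0) :
    d ≤ Module.finrank Fs I := by
  have := finite_of_isCentralSimple hA
  obtain ⟨-, ⟨α⟩⟩ := hA
  obtain ⟨v, hv⟩ : ∃ v, α x v ≠ 0 := by
    by_contra! h
    exact hx0 ((map_eq_zero_iff α α.injective).1 (LinearMap.ext h))
  -- Multiplying `x` by the rank-one operators `w ↦ φ(w) v` gives `w ↦ φ(w) x(v)`, which is
  -- injective in `φ` because `x(v) ≠ 0`. Thus the `d`-dimensional dual space embeds in `I`.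
  let T : Module.Dual Fs (Fin d → Fs) →ₗ[Fs] I :=
    { toFun := fun φ => ⟨x * α.symm (φ.smulRight v),
        I.smul_mem (MulOpposite.op (α.symm (φ.smulRight v))) hx⟩
      map_add' := fun φ ψ => Subtype.ext <| by
        change x * α.symm ((φ + ψ).smulRight v) = _ * _ + _ * _
        rw [← mul_add, ← map_add]
        congr 2
        ext; simp [add_mul]
      map_smul' := fun c φ => Subtype.ext <| by
        change x * α.symm ((c • φ).smulRight v) = c • (_ * _)
        rw [← mul_smul_comm, ← map_smul]
        congr 2
        ext; simp [mul_assoc] }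
  have hT : Function.Injective T := by
    rw [injective_iff_map_eq_zero]
    intro φ hφ
    have h0 : x * α.symm (φ.smulRight v) = 0 := congrArg Subtype.val hφ
    have h1 : α x * φ.smulRight v = 0 := by
      rw [← α.apply_symm_apply (φ.smulRight v), ← map_mul, h0, map_zero]
    refine LinearMap.ext fun w => ?_
    have h2 : φ w • α x v = 0 := by
      simpa using DFunLike.congr_fun h1 w
    exact (smul_eq_zero.1 h2).resolve_right hv
  have : Module.Finite Fs I :=
    inferInstanceAs (Module.Finite Fs (I.restrictScalars Fs))
  have h := LinearMap.finrank_le_finrank_of_injective hT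
  rwa [Subspace.dual_finrank_eq, Module.finrank_fin_fun] at h

end Degree

/-! ### The points attached to an embedded étale algebra -/

section EpsStar

variable {F Fs L : Type*} [Field F] [Field Fs] [Algebra F Fs] [CommRing L] [Algebra F L]
  {A : Type*} [Ring A] [Algebra F A]

lemma mem_epsStar {ε : L →ₐ[F] A} {ξ : EtaleSet F Fs L} {x : Fs ⊗[F] A} :
    x ∈ epsStar ε ξ ↔ ∀ l : L, ξ l • x = ((1 : Fs) ⊗ₜ[F] ε l) * x := Iff.rfl

variable (Fs) in
/-- The extension of `ε : L → A` to `Fs ⊗ L → A_s`. -/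
def epsExt (ε : L →ₐ[F] A) : (Fs ⊗[F] L) →ₐ[Fs] (Fs ⊗[F] A) :=
  Algebra.TensorProduct.map (AlgHom.id Fs Fs) ε

lemma epsExt_tmul (ε : L →ₐ[F] A) (c : Fs) (l : L) :
    epsExt Fs ε (c ⊗ₜ[F] l) = c ⊗ₜ[F] ε l := by
  simp [epsExt]

lemma epsExt_injective {ε : L →ₐ[F] A} (hε : Function.Injective ε) :
    Function.Injective (epsExt Fs ε) :=
  Module.Flat.lTensor_preserves_injective_linearMap (M := Fs) ε.toLinearMap hε

lemma epsExt_mul_of_mem {ε : L →ₐ[F] A} {ξ : EtaleSet F Fs L} {x : Fs ⊗[F] A}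
    (hx : x ∈ epsStar ε ξ) (z : Fs ⊗[F] L) :
    epsExt Fs ε z * x = etaleEval F Fs L z ξ • x := by
  induction z with
  | zero => simp
  | add y z hy hz => rw [map_add, add_mul, hy, hz, map_add, Pi.add_apply, add_smul]
  | tmul c l =>
    have h : (c ⊗ₜ[F] ε l : Fs ⊗[F] A) = c • ((1 : Fs) ⊗ₜ[F] ε l) := by
      rw [TensorProduct.smul_tmul', smul_eq_mul, mul_one]
    rw [epsExt_tmul, etaleEval_tmul, h, smul_mul_assoc, ← mem_epsStar.1 hx l, smul_smul]

variable [IsSepClosed Fs] [Algebra.Etale F L]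

/-- The image in `A_s` of the primitive idempotent attached to `ξ`. -/
def epsIdem (ε : L →ₐ[F] A) (ξ : EtaleSet F Fs L) : Fs ⊗[F] A :=
  epsExt Fs ε (etaleIdem ξ)

lemma epsIdem_ne_zero {ε : L →ₐ[F] A} (hε : Function.Injective ε) (ξ : EtaleSet F Fs L) :
    epsIdem ε ξ ≠ 0 :=
  (map_ne_zero_iff _ (epsExt_injective hε)).2 (etaleIdem_ne_zero ξ)

lemma epsIdem_mul_of_ne (ε : L →ₐ[F] A) {ξ η : EtaleSet F Fs L} (h : ξ ≠ η) :
    epsIdem ε ξ * epsIdem ε η = 0 := by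
  rw [epsIdem, epsIdem, ← map_mul, etaleIdem_mul_of_ne h, map_zero]

lemma sum_epsIdem [Fintype (EtaleSet F Fs L)] (ε : L →ₐ[F] A) :
    ∑ ξ : EtaleSet F Fs L, epsIdem ε ξ = 1 := by
  simp only [epsIdem]
  rw [← map_sum, sum_etaleIdem, map_one]

/-- Together with `epsIdem_mul_of_mem`, this identifies `ε_*(ξ)` with `e_ξ A_s`. -/
lemma epsIdem_mul_mem (ε : L →ₐ[F] A) (ξ : EtaleSet F Fs L) (x : Fs ⊗[F] A) :
    epsIdem ε ξ * x ∈ epsStar ε ξ := by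
  intro l
  rw [← epsExt_tmul, ← mul_assoc, epsIdem, ← map_mul, mul_etaleIdem, map_smul, etaleEval_tmul,
    one_mul, smul_mul_assoc]

lemma epsIdem_mul_of_mem {ε : L →ₐ[F] A} {ξ : EtaleSet F Fs L} {x : Fs ⊗[F] A}
    (hx : x ∈ epsStar ε ξ) : epsIdem ε ξ * x = x := by
  classical
  rw [epsIdem, epsExt_mul_of_mem hx, etaleEval_etaleIdem, Pi.single_eq_same, one_smul]

lemma epsIdem_mem (ε : L →ₐ[F] A) (ξ : EtaleSet F Fs L) : epsIdem ε ξ ∈ epsStar ε ξ := by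
  simpa using epsIdem_mul_mem ε ξ 1

lemma epsStar_injective {ε : L →ₐ[F] A} (hε : Function.Injective ε) :
    Function.Injective (epsStar ε : EtaleSet F Fs L → RightIdeal (Fs ⊗[F] A)) := by
  intro ξ η h
  by_contra hne
  refine epsIdem_ne_zero hε ξ ?_
  have h1 : epsIdem ε ξ ∈ epsStar ε η := h ▸ epsIdem_mem ε ξ
  rw [← epsIdem_mul_of_mem h1, epsIdem_mul_of_ne ε (Ne.symm hne)]

lemma sum_mem_grMap {X R : Type*} [Ring R] {φ : X → RightIdeal R} {s : Finset X} {g : X → R}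
    (hg : ∀ x ∈ s, g x ∈ φ x) : ∑ x ∈ s, g x ∈ grMap φ s :=
  Submodule.sum_mem _ fun x hx =>
    (le_iSup₂_of_le (f := fun x (_ : x ∈ s) => φ x) x hx le_rfl) (hg x hx)

lemma sum_epsIdem_mul_of_mem_grMap {ε : L →ₐ[F] A} {s : Finset (EtaleSet F Fs L)}
    {x : Fs ⊗[F] A} (hx : x ∈ grMap (epsStar ε) s) : (∑ ξ ∈ s, epsIdem ε ξ) * x = x := by
  classical
  -- The fixed elements of left multiplication by the partial sum form a right ideal, so it suffices
  -- to check that it contains each summand.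
  let I : RightIdeal (Fs ⊗[F] A) :=
    { carrier := {x | (∑ ξ ∈ s, epsIdem ε ξ) * x = x}
      zero_mem' := mul_zero _
      add_mem' := fun {x y} hx hy => by
        rw [Set.mem_ofPred_eq] at *
        rw [mul_add, hx, hy]
      smul_mem' := fun b x hx => by
        rw [Set.mem_ofPred_eq] at *
        change _ * (x * b.unop) = x * b.unop
        rw [← mul_assoc, hx] }
  have h : grMap (epsStar ε) s ≤ I := iSup₂_le fun ξ hξ y hy => by
    change (∑ ξ ∈ s, epsIdem ε ξ) * y = y
    rw [Finset.sum_mul, Finset.sum_eq_single_of_mem ξ hξ, epsIdem_mul_of_mem hy]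
    intro η _ hη
    rw [← epsIdem_mul_of_mem hy, ← mul_assoc, epsIdem_mul_of_ne ε hη, zero_mul]
  exact h hx

/-- `∑_{ξ ∈ s} ε_*(ξ)` is the direct sum of the right ideals `ε_*(ξ)`. -/
def grMapEquiv (ε : L →ₐ[F] A) (s : Finset (EtaleSet F Fs L)) :
    grMap (epsStar ε) s ≃ₗ[Fs] (∀ ξ : s, epsStar ε (ξ : EtaleSet F Fs L)) where
  toFun x ξ := ⟨epsIdem ε (ξ : EtaleSet F Fs L) * x, epsIdem_mul_mem ε _ _⟩
  map_add' x y := funext fun ξ => Subtype.ext (mul_add _ _ _)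
  map_smul' c x := funext fun ξ => Subtype.ext (mul_smul_comm _ _ _)
  invFun g := ⟨∑ ξ : s, (g ξ : Fs ⊗[F] A), by
    classical
    have h := sum_mem_grMap (φ := epsStar ε) (s := s)
      (g := fun ξ => if h : ξ ∈ s then (g ⟨ξ, h⟩ : Fs ⊗[F] A) else 0)
      fun ξ hξ => by simp only [hξ, dif_pos]; exact (g ⟨ξ, hξ⟩).2
    rw [← Finset.sum_coe_sort] at h
    simpa using h⟩
  left_inv x := Subtype.ext <| by
    change ∑ ξ : s, epsIdem ε (ξ : EtaleSet F Fs L) * (x : Fs ⊗[F] A) = x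
    rw [Finset.sum_coe_sort s fun ξ => epsIdem ε ξ * (x : Fs ⊗[F] A), ← Finset.sum_mul,
      sum_epsIdem_mul_of_mem_grMap x.2]
  right_inv g := funext fun ξ => Subtype.ext <| by
    change epsIdem ε (ξ : EtaleSet F Fs L) * ∑ η : s, (g η : Fs ⊗[F] A) = g ξ
    rw [Finset.mul_sum, Finset.sum_eq_single_of_mem ξ (Finset.mem_univ _),
      epsIdem_mul_of_mem (g ξ).2]
    intro η _ hη
    rw [← epsIdem_mul_of_mem (g η).2, ← mul_assoc,
      epsIdem_mul_of_ne ε fun h => hη (Subtype.ext h.symm), zero_mul]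

lemma eq_top_of_forall_epsStar_le (ε : L →ₐ[F] A) (I : RightIdeal (Fs ⊗[F] A))
    (hI : ∀ ξ : EtaleSet F Fs L, epsStar ε ξ ≤ I) : I = ⊤ := by
  have := finite_etaleSet F Fs L
  have := Fintype.ofFinite (EtaleSet F Fs L)
  have h1 : (1 : Fs ⊗[F] A) ∈ I := by
    rw [← sum_epsIdem ε]
    exact Submodule.sum_mem _ fun ξ _ => hI ξ (epsIdem_mem ε ξ)
  refine eq_top_iff.2 fun x _ => ?_
  have := I.smul_mem (MulOpposite.op x) h1
  rwa [op_smul_eq_mul, one_mul] at this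

lemma grMap_univ_eq_top [Fintype (EtaleSet F Fs L)] (ε : L →ₐ[F] A) :
    grMap (epsStar ε) (Finset.univ : Finset (EtaleSet F Fs L)) = ⊤ :=
  eq_top_of_forall_epsStar_le ε _ fun ξ =>
    le_iSup₂_of_le (f := fun ξ (_ : ξ ∈ Finset.univ) => epsStar ε ξ) ξ (Finset.mem_univ ξ) le_rfl

lemma finrank_grMap_eq_sum {d : ℕ} (hA : IsCentralSimpleOfDegree F Fs d A) (ε : L →ₐ[F] A)
    (s : Finset (EtaleSet F Fs L)) :
    Module.finrank Fs (grMap (epsStar ε) s)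
      = ∑ ξ ∈ s, Module.finrank Fs (epsStar ε ξ) := by
  have := finite_of_isCentralSimple hA
  have : ∀ ξ : EtaleSet F Fs L, Module.Finite Fs (epsStar ε ξ) := fun ξ =>
    inferInstanceAs (Module.Finite Fs ((epsStar ε ξ).restrictScalars Fs))
  rw [(grMapEquiv ε s).finrank_eq, Module.finrank_pi_fintype,
    Finset.sum_coe_sort s fun ξ => Module.finrank Fs (epsStar ε ξ)]

/-- The dimensions of the `d` summands add up to `d²`, and each is at least `d`; hence all these
inequalities are equalities. -/
lemma finrank_epsStar {d : ℕ} (hA : IsCentralSimpleOfDegree F Fs d A)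
    (hL : Module.finrank F L = d) {ε : L →ₐ[F] A} (hε : Function.Injective ε)
    (ξ : EtaleSet F Fs L) : Module.finrank Fs (epsStar ε ξ) = d := by
  have := finite_etaleSet F Fs L
  have := Fintype.ofFinite (EtaleSet F Fs L)
  have hle : ∀ η ∈ (Finset.univ : Finset (EtaleSet F Fs L)),
      d ≤ Module.finrank Fs (epsStar ε η) := fun η _ =>
    le_finrank_of_ne_zero hA (epsIdem_mem ε η) (epsIdem_ne_zero hε η)
  refine ((Finset.sum_eq_sum_iff_of_le hle).1 ?_ ξ (Finset.mem_univ ξ)).symm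
  rw [← finrank_grMap_eq_sum hA, grMap_univ_eq_top, Finset.sum_const, Finset.card_univ,
    ← Nat.card_eq_fintype_card, card_etaleSet, hL, smul_eq_mul, ← finrank_of_isCentralSimple hA]
  exact (finrank_top Fs (Fs ⊗[F] A)).symm

lemma finrank_grMap {d : ℕ} (hA : IsCentralSimpleOfDegree F Fs d A)
    (hL : Module.finrank F L = d) {ε : L →ₐ[F] A} (hε : Function.Injective ε)
    (s : Finset (EtaleSet F Fs L)) :
    Module.finrank Fs (grMap (epsStar ε) s) = d * s.card := by
  rw [finrank_grMap_eq_sum hA, Finset.sum_congr rfl fun ξ _ => finrank_epsStar hA hL hε ξ,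
    Finset.sum_const, smul_eq_mul, mul_comm]

end EpsStar

/-! ### Galois equivariance and general position -/

section Equivariance

variable {F Fs L : Type*} [Field F] [Field Fs] [Algebra F Fs] [CommRing L] [Algebra F L]
  {A : Type*} [Ring A] [Algebra F A]

/-- The automorphism `γ ⊗ id` fixes `1 ⊗ ε(l)` and turns the eigenvalue `ξ(l)` into `γ(ξ(l))`. -/
lemma galAut_mem_epsStar {ε : L →ₐ[F] A} (γ : Fs ≃ₐ[F] Fs) {ξ : EtaleSet F Fs L}
    {x : Fs ⊗[F] A} (hx : x ∈ epsStar ε ξ) : galAut A γ x ∈ epsStar ε (γ • ξ) := by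
  intro l
  have h := congrArg (galAut A γ) (hx l)
  rwa [galAut_smul, map_mul, galAut_tmul, map_one] at h

lemma epsStar_smul (ε : L →ₐ[F] A) (γ : Fs ≃ₐ[F] Fs) (ξ : EtaleSet F Fs L) :
    epsStar ε (γ • ξ) = galIdeal γ (epsStar ε ξ) := by
  refine le_antisymm (fun x hx => ?_) ?_
  · refine ⟨galAut A γ⁻¹ x, ?_, ?_⟩
    · have h := galAut_mem_epsStar γ⁻¹ hx
      rwa [inv_smul_smul] at h
    · exact (galAut A γ).apply_symm_apply x
  · rintro _ ⟨x, hx, rfl⟩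
    exact galAut_mem_epsStar γ hx

lemma isGeneralEmbedding_epsStar [IsSepClosure F Fs] [Algebra.Etale F L] {d : ℕ}
    (hA : IsCentralSimpleOfDegree F Fs d A) (hL : Module.finrank F L = d) {ε : L →ₐ[F] A}
    (hε : Function.Injective ε) :
    IsGeneralEmbedding d (epsStar ε : EtaleSet F Fs L → RightIdeal (Fs ⊗[F] A)) := by
  have : IsSepClosed Fs := IsSepClosure.sep_closed F
  exact
    { isGammaSet := isGammaSet_etaleSet
      card_eq := by rw [card_etaleSet, hL]
      mem_severiBrauer := fun ξ =>
        (finrank_epsStar hA hL hε ξ).trans (mul_one d).symm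
      injective := epsStar_injective hε
      equivariant := fun γ ξ => epsStar_smul ε γ ξ
      general_position := eq_top_of_forall_epsStar_le ε }

end Equivariance

/-! ### Isotropy -/

section Isotropy

variable {F Fs : Type*} [Field F] [Field Fs] [Algebra F Fs] {A : Type*} [Ring A] [Algebra F A]

lemma baseChange_map_mul {σ : A →ₗ[F] A} (hσ : IsInvolution σ) (x y : Fs ⊗[F] A) :
    σ.baseChange Fs (x * y) = σ.baseChange Fs y * σ.baseChange Fs x := by
  induction x with
  | zero => simp
  | add x x' hx hx' => rw [add_mul, map_add, hx, hx', map_add, mul_add]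
  | tmul c a =>
    induction y with
    | zero => simp
    | add y y' hy hy' => rw [mul_add, map_add, hy, hy', map_add, add_mul]
    | tmul c' a' => simp [hσ.map_mul, mul_comm c c']

/-- This is why every point of `SB(A)` contained in an isotropic ideal lies on the quadric. -/
lemma IsIsotropicIdeal.mono {σ : A →ₗ[F] A} {f : Sym σ →ₗ[F] F} {I J : RightIdeal (Fs ⊗[F] A)}
    (hI : IsIsotropicIdeal f I) (hJ : J ≤ I) : IsIsotropicIdeal f J :=
  ⟨fun x hx y hy => hI.1 x (hJ hx) y (hJ hy), fun x hx => hI.2 x (hJ hx)⟩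

/-- If `f` is the form `x ↦ Trd(a x)`, then its extension is `x ↦ tr(a x)`. -/
lemma extendForm_eq_trace [IsSepClosure F Fs] {d : ℕ} (hA : IsCentralSimpleOfDegree F Fs d A)
    {σ : A →ₗ[F] A} {f : Sym σ →ₗ[F] F} {a : A}
    (ha : ∀ x : Sym σ, f x = reducedTrace hA (a * x))
    (α : (Fs ⊗[F] A) ≃ₐ[Fs] Module.End Fs (Fin d → Fs)) (x : Sym (σ.baseChange Fs)) :
    extendForm Fs f x
      = LinearMap.trace Fs (Fin d → Fs) (α (((1 : Fs) ⊗ₜ[F] a) * (x : Fs ⊗[F] A))) := by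
  obtain ⟨z, rfl⟩ := (symBaseChange Fs σ).surjective x
  induction z with
  | zero => simp
  | add y z hy hz => simp only [map_add, hy, hz, Submodule.coe_add, mul_add]
  | tmul c y =>
    have h : ((1 : Fs) ⊗ₜ[F] a) * (c ⊗ₜ[F] (y : A)) = c • ((1 : Fs) ⊗ₜ[F] (a * y)) := by
      rw [Algebra.TensorProduct.tmul_mul_tmul, one_mul, TensorProduct.smul_tmul', smul_eq_mul,
        mul_one]
    rw [extendForm_tmul, symBaseChange_tmul, h, map_smul, map_smul, ha,
      algebraMap_reducedTrace hA α, smul_eq_mul]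

variable {L : Type*} [CommRing L] [Algebra F L]

/-- `σ(ε_*(ξ)) ε_*(η) = 0` unless `η = ξ ∘ σ_L`. -/
lemma baseChange_mul_eq_zero {σ : A →ₗ[F] A} (hσ : IsInvolution σ) {σL : L ≃ₐ[F] L}
    (hσL : ∀ l, σL (σL l) = l) {ε : L →ₐ[F] A} (hε : ∀ l, ε (σL l) = σ (ε l))
    {ξ η : EtaleSet F Fs L} (h : etaleSetMap Fs σL ξ ≠ η) {x y : Fs ⊗[F] A}
    (hx : x ∈ epsStar ε ξ) (hy : y ∈ epsStar ε η) : σ.baseChange Fs x * y = 0 := by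
  obtain ⟨l, hl⟩ : ∃ l, ξ (σL l) ≠ η l := by
    by_contra! h'
    exact h (AlgHom.ext h')
  -- Applying `σ_s` makes `σ_s(x)` an eigenvector for right multiplication by `ε(l)`, with
  -- eigenvalue `ξ(σ_L l)`. On `y`, left multiplication by `ε(l)` has the different eigenvalue
  -- `η(l)`.
  have h1 : ξ (σL l) • σ.baseChange Fs x = σ.baseChange Fs x * ((1 : Fs) ⊗ₜ[F] ε l) := by
    rw [← map_smul, hx (σL l), baseChange_map_mul hσ, LinearMap.baseChange_tmul, ← hε, hσL]
  have h2 : (ξ (σL l) - η l) • (σ.baseChange Fs x * y) = 0 := by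
    rw [sub_smul, ← smul_mul_assoc, h1, ← mul_smul_comm, hy l, mul_assoc, sub_self]
  exact (smul_eq_zero.1 h2).resolve_left (sub_ne_zero.2 hl)

lemma isIsotropicIdeal_grMap [IsSepClosure F Fs] [Algebra.Etale F L] {n : ℕ}
    {hA : IsCentralSimpleOfDegree F Fs (2 * n) A} {σ : A →ₗ[F] A} {f : Sym σ →ₗ[F] F}
    (hσ : IsInvolution σ) {σL : L ≃ₐ[F] L} (hσL : IsEtaleInvolution Fs σL) {ε : L →ₐ[F] A}
    (hε : IsInvolutionEmbedding hA σL σ f ε) {s : Finset (EtaleSet F Fs L)}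
    (hs : IsIsotropicSubset (etaleSetMap Fs σL) s) :
    IsIsotropicIdeal f (grMap (epsStar ε) s) := by
  have : IsSepClosed Fs := IsSepClosure.sep_closed F
  have hmul : ∀ x ∈ grMap (epsStar ε) s, ∀ y ∈ grMap (epsStar ε) s,
      σ.baseChange Fs x * y = 0 := by
    intro x hx y hy
    -- Both factors are split into components in the `ε_*(ξ)`; a nonzero cross term would need a
    -- pair `ξ`, `ξ ∘ σ_L` inside `s`.
    rw [← sum_epsIdem_mul_of_mem_grMap hx, ← sum_epsIdem_mul_of_mem_grMap hy, Finset.sum_mul,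
      Finset.sum_mul, map_sum, Finset.sum_mul_sum]
    refine Finset.sum_eq_zero fun ξ hξ => Finset.sum_eq_zero fun η hη => ?_
    refine baseChange_mul_eq_zero hσ hσL.involutive hε.map_involution (fun h => ?_)
      (epsIdem_mul_mem ε ξ x) (epsIdem_mul_mem ε η y)
    exact hs ξ hξ (h ▸ hη)
  refine ⟨hmul, fun x hx => ?_⟩
  obtain ⟨l, hl⟩ := exists_add_involution_eq_one hσL
  have ⟨α⟩ := hA.2
  set e : Fs ⊗[F] A := ∑ ξ ∈ s, epsIdem ε ξ
  have hel : e = epsExt Fs ε (∑ ξ ∈ s, etaleIdem ξ) := by rw [map_sum]; rfl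
  have hex : e * (x : Fs ⊗[F] A) = x := sum_epsIdem_mul_of_mem_grMap hx
  -- `e` itself lies in the ideal and `x = σ_s(x)`, so the vanishing of products applies to `x` and
  -- `e`.
  have hxe : (x : Fs ⊗[F] A) * e = 0 := by
    have h := hmul x hx e (sum_mem_grMap fun ξ _ => epsIdem_mem ε ξ)
    rwa [mem_Sym.1 x.2] at h
  have hcomm : ((1 : Fs) ⊗ₜ[F] ε l) * e = e * ((1 : Fs) ⊗ₜ[F] ε l) := by
    rw [hel, ← epsExt_tmul, ← map_mul, mul_comm, map_mul]
  -- `tr(ε(l) e x) = tr(e ε(l) x) = tr(ε(l) x e) = 0`.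
  rw [extendForm_eq_trace hA (fun y => hε.map_form y l hl) α, ← hex, ← mul_assoc, hcomm, mul_assoc,
    map_mul, LinearMap.trace_mul_comm, ← map_mul, mul_assoc, hxe, mul_zero, map_zero, map_zero]

end Isotropy

end ThinQuadric

end

open ThinQuadric in
theorem mainTheorem6 {F Fs : Type*} [Field F] [Field Fs] [Algebra F Fs] [IsSepClosure F Fs]
    (n : ℕ)
    {A : Type*} [Ring A] [Algebra F A]
    (hA : ThinQuadric.IsCentralSimpleOfDegree F Fs (2 * n) A)
    (σ : A →ₗ[F] A) (f : ThinQuadric.Sym σ →ₗ[F] F)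
    (hσf : ThinQuadric.IsQuadraticPair hA σ f)
    {L : Type*} [CommRing L] [Algebra F L] [Algebra.Etale F L]
    (hL : Module.finrank F L = 2 * n)
    (σL : L ≃ₐ[F] L) (hσL : ThinQuadric.IsEtaleInvolution Fs σL)
    (ε : L →ₐ[F] A) (hε : ThinQuadric.IsInvolutionEmbedding hA σL σ f ε) :
    ThinQuadric.IsQuadricEmbedding n
        (ThinQuadric.etaleSetMap Fs σL : ThinQuadric.EtaleSet F Fs L → ThinQuadric.EtaleSet F Fs L)
        (ThinQuadric.quadric Fs n f)
        (ThinQuadric.epsStar ε) ∧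
      (∀ s : Finset (ThinQuadric.EtaleSet F Fs L),
        ThinQuadric.IsIsotropicSubset (ThinQuadric.etaleSetMap Fs σL) s →
          ThinQuadric.IsIsotropicIdeal f (ThinQuadric.grMap (ThinQuadric.epsStar ε) s)) ∧
      (∀ ω ∈ ThinQuadric.cliffordSet
          (ThinQuadric.etaleSetMap Fs σL :
            ThinQuadric.EtaleSet F Fs L → ThinQuadric.EtaleSet F Fs L),
        ThinQuadric.grMap (ThinQuadric.epsStar ε) ω ∈
          ThinQuadric.cliffordSetOfQuadric n (ThinQuadric.quadric Fs n f)) := by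
  have hemb := isGeneralEmbedding_epsStar hA hL hε.injective
  have hthin := isThinQuadric_etaleSet hL hσL
  have hiso : ∀ s : Finset (EtaleSet F Fs L), IsIsotropicSubset (etaleSetMap Fs σL) s →
      IsIsotropicIdeal f (grMap (epsStar ε) s) := fun s hs =>
    isIsotropicIdeal_grMap hσf.isInvolution hσL hε hs
  have : IsSepClosed Fs := IsSepClosure.sep_closed F
  have hlin : ∀ s : Finset (EtaleSet F Fs L), IsIsotropicSubset (etaleSetMap Fs σL) s →
      grMap (epsStar ε) s ∈ linearVarietiesIn (2 * n) s.card (quadric Fs n f) := fun s hs =>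
    ⟨finrank_grMap hA hL hε.injective s, fun J hJ hle => ⟨hJ, (hiso s hs).mono hle⟩⟩
  refine ⟨⟨hthin, hemb, hlin⟩, hiso, fun ω hω => ?_⟩
  have hcard := two_mul_card_of_mem_cliffordSet hthin.involutive hthin.fixedPointFree hω
  rw [hthin.card_eq] at hcard
  have hn : ω.card = n := by omega
  have h := hlin ω hω.1
  rwa [hn] at h
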